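/- Let $\Sigma,\Delta,Q$ be finite sets and let $M=(\Sigma,\Delta,Q,q_0,\delta,\lambda)$ be a finite-state transducer: $q_0\in Q$, $\delta:Q\times\Sigma\to Q$, $\lambda:Q\times\Sigma\to\Delta^*$ (empty outputs are allowed). For an infinite word $x=x_0x_1x_2\cdots\in\Sigma^\omega$ let $M(x)$ be the finite or infinite word $\lambda(q_0,x_0)\,\lambda(q_1,x_1)\,\lambda(q_2,x_2)\cdots$, where $q_{i+1}=\delta(q_i,x_i)$. Call an infinite word $x\in\Gamma^\omega$ over a finite alphabet $\Gamma$ *morphic* if there are a finite alphabet $A$, a morphism $h:A\to A^*$ (extended to $A^*$ by concatenation, possibly erasing), a nonempty word $s\in A^+$ and a coding (letter-to-letter map) $c:A\to\Gamma$ such that the limit $h^\omega(s)=\lim_{n\to\infty}h^n(s)$ exists and is infinite, and $x=c(h^\omega(s))$. (A sequence of finite words converges to an infinite word $w$ if, for every $i$, all but finitely many of the words have an $i$-th letter and it equals that of $w$.) **Theorem (Dekking).** If $x\in\Sigma^\omega$ is morphic, then $M(x)$ is a morphic sequence or a finite word. -/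

import Mathlib

open Filter

/-- The extension of a morphism `h : A → B*` to finite words, by concatenation. -/
def extendMorphism {A B : Type*} (h : A → List B) (w : List A) : List B :=
  w.flatMap h

/-- Convergence of a sequence of finite words to a finite or infinite word
(`Stream'.Seq A` is the type of finite or infinite words over `A`): at every position, the
symbol (or the absence of a symbol) eventually agrees with that of the limit. -/
def WordTendsto {A : Type*} (u : ℕ → List A) (w : Stream'.Seq A) : Prop :=
  ∀ i : ℕ, ∀ᶠ n in atTop, (u n)[i]? = w.get? i

/-- `w` is a pure morphic sequence: `w` is infinite and `w = lim hⁿ(s)` for a morphism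
`h : A → A*` and a nonempty word `s`. -/
def IsPureMorphic {A : Type*} (w : Stream' A) : Prop :=
  ∃ (h : A → List A) (s : List A), s ≠ [] ∧
    WordTendsto (fun n => (extendMorphism h)^[n] s) (Stream'.Seq.ofStream w)

/-- `x` is a morphic sequence: the image under a coding (a letter-to-letter map) of a pure
morphic sequence over a finite alphabet. -/
def IsMorphic {Γ : Type*} (x : Stream' Γ) : Prop :=
  ∃ (A : Type) (_ : Finite A) (w : Stream' A) (c : A → Γ), IsPureMorphic w ∧ x = w.map c

/-- A sequential transducer with input alphabet `S`, output alphabet `D` and state set `Q`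
(finiteness of the three types is stated where transducers are used). -/
structure Transducer (S D Q : Type*) where
  /-- the initial state -/
  start : Q
  /-- the transition function -/
  step : Q → S → Q
  /-- the output function -/
  out : Q → S → List D

namespace Transducer

variable {S D Q : Type*} (M : Transducer S D Q)

/-- The output function on finite words:
`out q ε = ε` and `out q (a w) = (out q a) (out (step q a) w)`. -/
def outWord : Q → List S → List D
  | _, [] => []
  | q, a :: w => M.out q a ++ outWord (M.step q a) w

open Classical in
/-- The output of `M`, started in state `q`, on a finite or infinite word `w`: the `i`-th symbol
is the `i`-th symbol of the output on the first prefix of `w` whose output has more than `i`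
symbols; there is no `i`-th symbol if no prefix has such an output. -/
noncomputable def outFrom (q : Q) (w : Stream'.Seq S) : Stream'.Seq D :=
  ⟨fun i =>
    if h : ∃ n, i < (M.outWord q (w.take n)).length then
      some ((M.outWord q (w.take (Nat.find h)))[i]'(Nat.find_spec h))
    else none, by
    intro i hi
    by_cases h : ∃ n, i + 1 < (M.outWord q (w.take n)).length
    · obtain ⟨n, hn⟩ := h
      have h' : ∃ n, i < (M.outWord q (w.take n)).length := ⟨n, by omega⟩
      simp only [dif_pos h'] at hi
      exact absurd hi (by simp)
    · exact dif_neg h⟩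

/-- `M(w)`, the output of `M` on a finite or infinite word `w`. -/
noncomputable def output (w : Stream'.Seq S) : Stream'.Seq D :=
  M.outFrom M.start w

end Transducer

/-!
Write `x` as the image under a coding of `w = lim hⁿ(s)`. The proof has two stages.

*From a transducer to a morphism.* A transition function of the transducer extends to words, so
`h, h², h³, …` induce a sequence of maps `A → Q → Q`, each determined by the one before. As there
are finitely many such maps, some power of `h` induces the same map as its square, and `h` may be
replaced by that power. Then attach to every letter of `w` the pair of states reached after the
prefix `u` before it and after `h(u)`. These pairs evolve along `h`, so the annotated word is again
pure morphic (`annotate_iterate`), and the transducer acts on it letter by letter, that is, as a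
possibly erasing morphism.

*Erasing morphic images* (`IsPureMorphic.exists_isMorphic_of_unbounded`). Let `f` be a morphism with
`f(w)` infinite. After passing to a power of `h`, a letter erased by `h²` is erased by `h`, and a
letter erased by `f ∘ h` is erased by `f ∘ h²`. The first property bounds the blocks of erased
letters in `h(u)`, so `h(w)` is infinite and `h(w) = w`. By the second property there is a morphism
`ψ` on the alphabet of pairs `(a, i)`, `i < |f(h(a))|`, with `ψ ∘ α = α ∘ h`, where `α` sends a
letter `a` to `(a, 0) (a, 1) ⋯`: let `(a, 0)` produce all of `α(h(a))`, and erase the other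
`(a, i)`. Hence `α(w) = lim ψⁿ(α(s))`, and the coding `(a, i) ↦ f(h(a))ᵢ` maps it to
`f(h(w)) = f(w)`.
-/

/-! ### Limits of sequences of words -/

theorem wordTendsto_ofStream_iff {A : Type*} {u : ℕ → List A} {w : Stream' A} :
    WordTendsto u (Stream'.Seq.ofStream w) ↔ ∀ L, ∀ᶠ n in atTop, w.take L <+: u n := by
  have get_eq (i : ℕ) : (Stream'.Seq.ofStream w).get? i = some (w.get i) := rfl
  constructor
  · intro h L
    have h' : ∀ᶠ n in atTop, ∀ i ∈ Finset.range L, (u n)[i]? = some (w.get i) :=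
      (Filter.eventually_all_finset _).2 fun i _ => h i
    filter_upwards [h'] with n hn
    rw [List.prefix_iff_getElem?]
    intro i hi
    rw [Stream'.length_take] at hi
    rw [hn i (Finset.mem_range.2 hi), ← Stream'.getElem?_take hi, List.getElem?_eq_getElem]
  · intro h i
    filter_upwards [h (i + 1)] with n hn
    have hi : i < (w.take (i + 1)).length := by simp
    rw [List.prefix_iff_getElem?.1 hn i hi, get_eq, ← Stream'.getElem?_take (Nat.lt_succ_self i),
      List.getElem?_eq_getElem hi]

theorem Stream'.take_prefix_take {A : Type*} (w : Stream' A) {m n : ℕ} (h : m ≤ n) :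
    w.take m <+: w.take n := by
  have := List.take_prefix m (w.take n)
  rwa [Stream'.take_take, Nat.min_eq_right h] at this

theorem Stream'.eq_take_of_prefix_take {A : Type*} {v : List A} {w : Stream' A} {n : ℕ}
    (h : v <+: w.take n) : v = w.take v.length := by
  have hle : v.length ≤ n := by simpa using h.length_le
  exact (List.prefix_of_prefix_length_le h (Stream'.take_prefix_take w hle)
    (by simp)).eq_of_length (by simp)

/-- If ever longer words `v L` are prefixes of almost all words `u n`, then `u` converges to an
infinite word that has every `v L` as a prefix. -/
theorem exists_wordTendsto_of_eventually_prefix {B : Type*} {u v : ℕ → List B}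
    (h : ∀ L, ∀ᶠ n in atTop, v L <+: u n) (hinf : ∀ N, ∃ L, N < (v L).length) :
    ∃ y : Stream' B, WordTendsto u (Stream'.Seq.ofStream y) ∧ ∀ L, v L = y.take (v L).length := by
  choose l hl using hinf
  let y : Stream' B := fun i => (v (l i))[i]'(hl i)
  have key (L : ℕ) : v L = y.take (v L).length := by
    apply List.ext_getElem?
    intro i
    by_cases hi : i < (v L).length
    · obtain ⟨n, h₁, h₂⟩ := ((h L).and (h (l i))).exists
      rw [Stream'.getElem?_take hi, List.getElem?_eq_getElem hi,
        ← List.prefix_iff_getElem?.1 h₁ i hi,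
        List.prefix_iff_getElem?.1 h₂ i (hl i)]
      rfl
    · rw [List.getElem?_eq_none (by omega), List.getElem?_eq_none (by simp; omega)]
  refine ⟨y, wordTendsto_ofStream_iff.2 fun L => ?_, key⟩
  filter_upwards [h (l L)] with n hn
  rw [key (l L)] at hn
  refine List.IsPrefix.trans ?_ hn
  exact Stream'.take_prefix_take y (hl L).le

theorem WordTendsto.eq_take_of_eventually_prefix {A : Type*} {u : ℕ → List A} {w : Stream' A}
    (hw : WordTendsto u (Stream'.Seq.ofStream w)) {v : List A} (hv : ∀ᶠ n in atTop, v <+: u n) :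
    v = w.take v.length := by
  obtain ⟨n, h₁, h₂⟩ := (hv.and (wordTendsto_ofStream_iff.1 hw v.length)).exists
  exact (List.prefix_of_prefix_length_le h₁ h₂ (by simp)).eq_of_length (by simp)

/-! ### Powers of a morphism -/

theorem extendMorphism_append {A B : Type*} (h : A → List B) (u v : List A) :
    extendMorphism h (u ++ v) = extendMorphism h u ++ extendMorphism h v :=
  List.flatMap_append

theorem extendMorphism_cons {A B : Type*} (h : A → List B) (a : A) (v : List A) :
    extendMorphism h (a :: v) = h a ++ extendMorphism h v :=
  List.flatMap_cons

theorem extendMorphism_singleton {A B : Type*} (h : A → List B) (a : A) :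
    extendMorphism h [a] = h a := by
  simp [extendMorphism]

theorem extendMorphism_extendMorphism {A B C : Type*} (h : A → List B) (f : B → List C)
    (u : List A) :
    extendMorphism f (extendMorphism h u) = extendMorphism (fun a => extendMorphism f (h a)) u :=
  List.flatMap_assoc

theorem extendMorphism_eq_nil_iff {A B : Type*} {h : A → List B} {u : List A} :
    extendMorphism h u = [] ↔ ∀ a ∈ u, h a = [] :=
  List.flatMap_eq_nil_iff

/-- The `n`-th power of a morphism, as a map on letters. -/
def morphismPow {A : Type*} (h : A → List A) (n : ℕ) (a : A) : List A :=
  (extendMorphism h)^[n] [a]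

theorem morphismPow_succ {A : Type*} (h : A → List A) (n : ℕ) (a : A) :
    morphismPow h (n + 1) a = (extendMorphism h)^[n] (h a) := by
  simp [morphismPow, extendMorphism_singleton]

theorem extendMorphism_morphismPow {A : Type*} (h : A → List A) (n : ℕ) :
    extendMorphism (morphismPow h n) = (extendMorphism h)^[n] := by
  induction n with
  | zero =>
    funext u
    exact List.flatMap_singleton' u
  | succ n ih =>
    funext u
    rw [Function.iterate_succ_apply, ← ih, extendMorphism_extendMorphism]
    congr 1
    funext a
    rw [morphismPow_succ, ih]

theorem extendMorphism_morphismPow_self {A : Type*} (h : A → List A) (p : ℕ) (a : A) :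
    extendMorphism (morphismPow h p) (morphismPow h p a) = morphismPow h (2 * p) a := by
  rw [extendMorphism_morphismPow, morphismPow, morphismPow, ← Function.iterate_add_apply, two_mul]

theorem WordTendsto.morphismPow {A : Type*} {h : A → List A} {s : List A} {w : Stream'.Seq A}
    (hw : WordTendsto (fun n => (extendMorphism h)^[n] s) w) {p : ℕ} (hp : 0 < p) :
    WordTendsto (fun n => (extendMorphism (morphismPow h p))^[n] s) w := by
  intro i
  have := (Filter.tendsto_id.const_mul_atTop' hp).eventually (hw i)
  simpa [extendMorphism_morphismPow, ← Function.iterate_mul] using this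

/-- In an eventually periodic sequence the term at a positive, large enough multiple `p` of the
period equals the term at `2 * p`. -/
theorem exists_pos_two_mul_eq {X : Type*} [Finite X] (x : ℕ → X)
    (hx : ∀ i j, x i = x j → x (i + 1) = x (j + 1)) : ∃ p, 0 < p ∧ x (2 * p) = x p := by
  obtain ⟨i, j, hij, h⟩ : ∃ i j, i < j ∧ x i = x j := by
    obtain ⟨i, j, hne, h⟩ := Finite.exists_ne_map_eq_of_infinite x
    rcases hne.lt_or_gt with hlt | hlt
    · exact ⟨i, j, hlt, h⟩
    · exact ⟨j, i, hlt, h.symm⟩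
  obtain ⟨d, hd, rfl⟩ : ∃ d, 0 < d ∧ j = i + d := ⟨j - i, by omega, by omega⟩
  have period (n : ℕ) : x (i + n + d) = x (i + n) := by
    induction n with
    | zero => simpa using h.symm
    | succ n ih => simpa [add_assoc, add_comm, add_left_comm] using hx _ _ ih
  have mul_period (n k : ℕ) : x (i + n + k * d) = x (i + n) := by
    induction k with
    | zero => simp
    | succ k ih =>
      rw [← ih, Nat.succ_mul, ← add_assoc, add_assoc i n, period]
  refine ⟨(i + 1) * d, by positivity, ?_⟩
  have hle : i ≤ (i + 1) * d := by nlinarith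
  obtain ⟨n, hn⟩ := Nat.exists_eq_add_of_le hle
  have := mul_period n (i + 1)
  rwa [← hn, ← two_mul] at this

/-! ### Erasing images of pure morphic words -/

/-- A pure morphic word over a finite alphabet in any universe has morphic codings: the alphabet
can be replaced by some `Fin n`. -/
theorem IsPureMorphic.isMorphic_map {B : Type*} {Γ : Type*} [Finite B] {w : Stream' B}
    (hw : IsPureMorphic w) (c : B → Γ) : IsMorphic (w.map c) := by
  obtain ⟨h, s, hs, hlim⟩ := hw
  obtain ⟨n, ⟨e⟩⟩ := Finite.exists_equiv_fin B
  let g : Fin n → List (Fin n) := fun i => (h (e.symm i)).map e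
  have semiconj : Function.Semiconj (List.map e) (extendMorphism h) (extendMorphism g) := by
    intro u
    simp [extendMorphism, g, List.map_flatMap, List.flatMap_map]
  refine ⟨Fin n, inferInstance, w.map e, c ∘ e.symm, ⟨g, s.map e, by simpa using hs, ?_⟩, ?_⟩
  · intro i
    filter_upwards [hlim i] with k hk
    rw [← (semiconj.iterate_right k) s, List.getElem?_map, hk]
    rfl
  · apply Stream'.ext
    intro i
    simp [Stream'.get_map]

theorem List.prefix_append_cases {A : Type*} {v l₁ l₂ : List A} (h : v <+: l₁ ++ l₂) :
    v <+: l₁ ∨ ∃ t, v = l₁ ++ t ∧ t <+: l₂ := by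
  rcases List.prefix_or_prefix_of_prefix h (List.prefix_append l₁ l₂) with h₁ | ⟨t, rfl⟩
  · exact Or.inl h₁
  · exact Or.inr ⟨t, rfl, (List.prefix_append_right_inj l₁).1 h⟩

/-- If every letter erased by `h²` is already erased by `h`, then `h` cannot shorten a prefix of an
image under `h` by more than a constant factor. -/
theorem exists_length_le_of_prefix_extendMorphism {A : Type*} [Finite A] {h : A → List A}
    (herase : ∀ a, extendMorphism h (h a) = [] → h a = []) :
    ∃ C, ∀ u v, v <+: extendMorphism h u → v.length ≤ C * (1 + (extendMorphism h v).length) := by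
  obtain ⟨C, hC⟩ := (Set.finite_range fun a => (h a).length).bddAbove
  have hC (a : A) : (h a).length ≤ C := hC ⟨a, rfl⟩
  refine ⟨C, fun u => ?_⟩
  induction u with
  | nil =>
    intro v hv
    have : v = [] := by simpa [extendMorphism] using hv
    simp [this]
  | cons a u ih =>
    intro v hv
    rw [extendMorphism_cons] at hv
    rcases List.prefix_append_cases hv with hv | ⟨t, rfl, ht⟩
    · calc v.length ≤ C := hv.length_le.trans (hC a)
        _ ≤ _ := Nat.le_mul_of_pos_right _ (by omega)
    · specialize ih t ht
      rw [extendMorphism_append, List.length_append, List.length_append]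
      by_cases ha : h a = []
      · simpa [ha, extendMorphism] using ih
      · have := List.length_pos_iff.2 (mt (herase a) ha)
        have := hC a
        nlinarith

/-- The set of letters erased by `hⁿ` and the set of those erased by `f ∘ hⁿ` determine the
corresponding sets for `n + 1`, so a suitable power `p` has the same sets as `2 * p`. -/
theorem exists_pos_morphismPow_erasing {A D : Type*} [Finite A] (h : A → List A)
    (f : A → List D) : ∃ p, 0 < p ∧
      (∀ a, morphismPow h (2 * p) a = [] ↔ morphismPow h p a = []) ∧
      ∀ a, extendMorphism f (morphismPow h (2 * p) a) = [] ↔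
        extendMorphism f (morphismPow h p a) = [] := by
  obtain ⟨p, hp, hx⟩ := exists_pos_two_mul_eq
    (fun n (a : A) => (morphismPow h n a = [], extendMorphism f (morphismPow h n a) = [])) (by
      intro i j hij
      have step (n : ℕ) (a : A) :
          morphismPow h (n + 1) a = extendMorphism (morphismPow h n) (h a) := by
        rw [morphismPow_succ, extendMorphism_morphismPow]
      funext a
      have hij (b : A) := congrFun hij b
      simp only [Prod.mk.injEq] at hij
      simp only [step, extendMorphism_extendMorphism,
        extendMorphism_eq_nil_iff (h := morphismPow h _),
        extendMorphism_eq_nil_iff (h := fun a => extendMorphism f (morphismPow h _ a)), hij])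
  have hx (a : A) := congrFun hx a
  simp only [Prod.mk.injEq, eq_iff_iff] at hx
  exact ⟨p, hp, fun a => (hx a).1, fun a => (hx a).2⟩

/-- The word `(a, 0) (a, 1) ⋯ (a, |F a| - 1)` that stands for the letters of `F a`. -/
def occurrences {A D : Type*} (F : A → List D) (a : A) : List (Σ a, Fin (F a).length) :=
  (List.finRange (F a).length).map (Sigma.mk a)

/-- The letter of `F a` at the occurrence `(a, i)`. -/
def occurrenceLetter {A D : Type*} (F : A → List D) (b : Σ a, Fin (F a).length) : D :=
  (F b.1)[b.2]

/-- The morphism on occurrences induced by `h`: the first occurrence `(a, 0)` in `F a` produces the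
occurrences in `F (h a)`, and the others are erased. -/
def occurrenceMorphism {A D : Type*} (h : A → List A) (F : A → List D)
    (b : Σ a, Fin (F a).length) : List (Σ a, Fin (F a).length) :=
  if b.2.val = 0 then extendMorphism (occurrences F) (h b.1) else []

theorem map_occurrenceLetter {A D : Type*} (F : A → List D) (u : List A) :
    (extendMorphism (occurrences F) u).map (occurrenceLetter F) = extendMorphism F u := by
  rw [extendMorphism, List.map_flatMap, extendMorphism]
  congr 1
  funext a
  apply List.ext_getElem <;> simp [occurrences, occurrenceLetter]

theorem length_occurrences {A D : Type*} (F : A → List D) (u : List A) :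
    (extendMorphism (occurrences F) u).length = (extendMorphism F u).length := by
  rw [← map_occurrenceLetter F u, List.length_map]

theorem exists_finRange_eq_cons {n : ℕ} (hn : 0 < n) :
    ∃ l, List.finRange n = ⟨0, hn⟩ :: l ∧ ∀ i ∈ l, i.val ≠ 0 := by
  obtain ⟨k, rfl⟩ := Nat.exists_eq_succ_of_ne_zero hn.ne'
  exact ⟨_, List.finRange_succ, by simp⟩

/-- The relation `ψ ∘ α = α ∘ h`. A letter with `F a = []` has no occurrence that could produce
those of `F (h a)`, whence the hypothesis. -/
theorem occurrenceMorphism_semiconj {A D : Type*} {h : A → List A} {F : A → List D}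
    (herase : ∀ a, F a = [] → extendMorphism F (h a) = []) :
    Function.Semiconj (extendMorphism (occurrences F)) (extendMorphism h)
      (extendMorphism (occurrenceMorphism h F)) := by
  intro u
  rw [extendMorphism_extendMorphism, extendMorphism_extendMorphism]
  -- Both sides are morphisms, so it suffices to compare them on letters.
  congr 1
  funext a
  by_cases ha : F a = []
  · have h₁ : extendMorphism (occurrences F) (h a) = [] :=
      List.length_eq_zero_iff.1 (by rw [length_occurrences, herase a ha, List.length_nil])
    have h₂ : occurrences F a = [] := by simp [occurrences, ha]
    rw [h₁, h₂]
    rfl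
  · have hpos : 0 < (F a).length := List.length_pos_iff.2 ha
    obtain ⟨l, hl, hl₀⟩ := exists_finRange_eq_cons hpos
    have herased : extendMorphism (occurrenceMorphism h F) (l.map (Sigma.mk a)) = [] := by
      rw [extendMorphism_eq_nil_iff, List.forall_mem_map]
      exact fun i hi => if_neg (hl₀ i hi)
    rw [occurrences, hl, List.map_cons, extendMorphism_cons, herased, List.append_nil]
    exact (if_pos rfl).symm

/-- Cobham's theorem on erasing morphisms: if the image of a pure morphic word under a morphism is
infinite, then it is morphic. -/
theorem IsPureMorphic.exists_isMorphic_of_unbounded {A D : Type*} [Finite A] {w : Stream' A}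
    (hw : IsPureMorphic w) (f : A → List D)
    (hinf : ∀ N, ∃ L, N < (extendMorphism f (w.take L)).length) :
    ∃ y : Stream' D, IsMorphic y ∧
      ∀ L, extendMorphism f (w.take L) = y.take (extendMorphism f (w.take L)).length := by
  obtain ⟨h₀, s, -, hlim₀⟩ := hw
  obtain ⟨p, hp, herase, hferase⟩ := exists_pos_morphismPow_erasing h₀ f
  set h := morphismPow h₀ p with hdef
  have hlim : WordTendsto (fun n => (extendMorphism h)^[n] s) (Stream'.Seq.ofStream w) :=
    hlim₀.morphismPow hp
  simp only [← extendMorphism_morphismPow_self, ← hdef] at herase hferase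
  let F : A → List D := fun a => extendMorphism f (h a)
  have hpre := wordTendsto_ofStream_iff.1 hlim
  obtain ⟨C, hC⟩ := exists_length_le_of_prefix_extendMorphism fun a => (herase a).1
  -- The equation `h(w) = w`, for prefixes.
  have image_eq (L : ℕ) :
      extendMorphism h (w.take L) = w.take (extendMorphism h (w.take L)).length := by
    refine hlim.eq_take_of_eventually_prefix ?_
    rw [← Filter.map_add_atTop_eq_nat 1, Filter.eventually_map]
    filter_upwards [hpre L] with n hn
    rw [Function.iterate_succ_apply']
    exact hn.flatMap h
  have length_le (L : ℕ) : L ≤ C * (1 + (extendMorphism h (w.take L)).length) := by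
    obtain ⟨n, hn, hn₁⟩ := ((hpre L).and (eventually_ge_atTop 1)).exists
    obtain ⟨m, rfl⟩ := Nat.exists_eq_add_of_le' hn₁
    rw [Function.iterate_succ_apply'] at hn
    simpa using hC _ _ hn
  have long (N : ℕ) : ∃ L, w.take N <+: extendMorphism h (w.take L) := by
    -- By `length_le`, a prefix of length `C * N + 1` has an image of length at least `N`.
    refine ⟨C * N + 1, ?_⟩
    have := length_le (C * N + 1)
    have hN : N ≤ (extendMorphism h (w.take (C * N + 1))).length := by
      by_contra! hlt
      nlinarith
    rw [image_eq]
    exact Stream'.take_prefix_take w hN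
  have hconj := occurrenceMorphism_semiconj (h := h) (F := F) fun a ha => by
    rw [← extendMorphism_extendMorphism]
    exact (hferase a).2 ha
  obtain ⟨z, hz, hztake⟩ := exists_wordTendsto_of_eventually_prefix
    (u := fun n => (extendMorphism (occurrenceMorphism h F))^[n] (extendMorphism (occurrences F) s))
    (v := fun L => extendMorphism (occurrences F) (w.take L))
    (fun L => by
      filter_upwards [hpre L] with n hn
      rw [← (hconj.iterate_right n) s]
      exact hn.flatMap _)
    (fun N => by
      obtain ⟨L₀, hL₀⟩ := hinf N
      obtain ⟨L, hL⟩ := long L₀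
      refine ⟨L, hL₀.trans_le ?_⟩
      rw [length_occurrences, ← extendMorphism_extendMorphism]
      exact (hL.flatMap f).length_le)
  -- The empty word is fixed by every morphism and does not converge to an infinite word.
  have hs : extendMorphism (occurrences F) s ≠ [] := by
    intro hs
    obtain ⟨n, hn⟩ := (wordTendsto_ofStream_iff.1 hz 1).exists
    have fixed := Function.iterate_fixed
      (f := extendMorphism (occurrenceMorphism h F)) (x := []) rfl n
    rw [hs, fixed] at hn
    simpa using hn.length_le
  refine ⟨z.map (occurrenceLetter F), IsPureMorphic.isMorphic_map ⟨_, _, hs, hz⟩ _, fun L => ?_⟩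
  obtain ⟨L', hL'⟩ := long L
  have hprefix : extendMorphism f (w.take L) <+: extendMorphism F (w.take L') := by
    rw [← extendMorphism_extendMorphism]
    exact hL'.flatMap f
  rw [← map_occurrenceLetter F, hztake L', Stream'.map_take] at hprefix
  exact Stream'.eq_take_of_prefix_take hprefix

/-! ### Annotation by states -/

/-- The word over `A × Q × Q` obtained from a word over `A` by recording, before every letter, two
states: the first is updated by the letter `a` itself, the second by the word `h a`. -/
def annotate {A Q : Type*} (step : Q → A → Q) (h : A → List A) : Q × Q → List A → List (A × Q × Q)
  | _, [] => []
  | r, a :: u => (a, r) :: annotate step h (step r.1 a, (h a).foldl step r.2) u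

section Annotate

variable {A Q : Type*} (step : Q → A → Q) (h : A → List A)

theorem annotate_append (r : Q × Q) (u v : List A) :
    annotate step h r (u ++ v) = annotate step h r u ++
      annotate step h (u.foldl step r.1, (extendMorphism h u).foldl step r.2) v := by
  induction u generalizing r with
  | nil => rfl
  | cons a u ih => simp [annotate, ih, extendMorphism_cons]

theorem length_annotate (r : Q × Q) (u : List A) : (annotate step h r u).length = u.length := by
  induction u generalizing r with
  | nil => rfl
  | cons a u ih => simp [annotate, ih]

/-- The morphism on annotated letters that lies over `h`: the second state before a letter is the
first state before its image. -/
def annotateMorphism (b : A × Q × Q) : List (A × Q × Q) :=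
  annotate step h (b.2.2, b.2.2) (h b.1)

variable {step h}

/-- Annotation commutes with `h` from any pair of states: the image of a letter annotated with
`(q, q')` starts at `(q', q')`, and the two states agree again after each image of a letter, since
`h a` and `h (h a)` act alike on states. -/
theorem annotate_extendMorphism
    (hstep : ∀ a q, (extendMorphism h (h a)).foldl step q = (h a).foldl step q)
    (r : Q × Q) (u : List A) :
    annotate step h (r.2, r.2) (extendMorphism h u) =
      extendMorphism (annotateMorphism step h) (annotate step h r u) := by
  induction u generalizing r with
  | nil => rfl
  | cons a u ih =>
    rw [extendMorphism_cons, annotate_append, annotate, extendMorphism_cons, ← ih]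
    simp [annotateMorphism, hstep]

theorem annotate_iterate
    (hstep : ∀ a q, (extendMorphism h (h a)).foldl step q = (h a).foldl step q)
    (q : Q) (u : List A) (n : ℕ) :
    annotate step h (q, q) ((extendMorphism h)^[n] u) =
      (extendMorphism (annotateMorphism step h))^[n] (annotate step h (q, q) u) := by
  have : Function.Semiconj (annotate step h (q, q)) (extendMorphism h)
      (extendMorphism (annotateMorphism step h)) := annotate_extendMorphism hstep (q, q)
  exact (this.iterate_right n) u

end Annotate

/-- The action of the words `hⁿ(a)` on states determines that of the words `hⁿ⁺¹(a)`, so some power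
of `h` acts as its square does. -/
theorem exists_pos_morphismPow_foldl {A Q : Type*} [Finite A] [Finite Q] (step : Q → A → Q)
    (h : A → List A) : ∃ p, 0 < p ∧
      ∀ a q, (morphismPow h (2 * p) a).foldl step q = (morphismPow h p a).foldl step q := by
  obtain ⟨p, hp, hx⟩ := exists_pos_two_mul_eq
    (fun n (a : A) (q : Q) => (morphismPow h n a).foldl step q) (by
      intro i j hij
      have hij (a : A) (q : Q) := congrFun (congrFun hij a) q
      have key (u : List A) (q : Q) : (extendMorphism (morphismPow h i) u).foldl step q =
          (extendMorphism (morphismPow h j) u).foldl step q := by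
        induction u generalizing q with
        | nil => rfl
        | cons a u ih => rw [extendMorphism_cons, extendMorphism_cons, List.foldl_append,
            List.foldl_append, ih, hij]
      funext a q
      simp only [morphismPow_succ, ← extendMorphism_morphismPow, key])
  exact ⟨p, hp, fun a q => congrFun (congrFun hx a) q⟩

/-! ### Transducers -/

theorem Stream'.Seq.take_ofStream {A : Type*} (w : Stream' A) (n : ℕ) :
    (Stream'.Seq.ofStream w).take n = w.take n := by
  apply List.ext_getElem?
  intro i
  rw [Stream'.Seq.getElem?_take]
  split_ifs with hi
  · rw [Stream'.getElem?_take hi]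
    rfl
  · rw [List.getElem?_eq_none (by simp; omega)]

namespace Transducer

variable {S D Q : Type*} (M : Transducer S D Q)

/-- On annotated words the transducer acts as a morphism, which reads the state off the letter. -/
theorem outWord_map {A : Type*} (c : A → S) (h : A → List A) (r : Q × Q) (u : List A) :
    M.outWord r.1 (u.map c) = extendMorphism (fun b : A × Q × Q => M.out b.2.1 (c b.1))
      (annotate (fun q a => M.step q (c a)) h r u) := by
  induction u generalizing r with
  | nil => rfl
  | cons a u ih =>
    rw [annotate, extendMorphism_cons, ← ih]
    rfl

theorem output_terminates {w : Stream'.Seq S} {N : ℕ}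
    (hN : ∀ n, (M.outWord M.start (w.take n)).length ≤ N) : (M.output w).Terminates :=
  ⟨N, dif_neg fun ⟨n, hn⟩ => (hN n).not_gt hn⟩

theorem output_eq_ofStream {w : Stream'.Seq S} {y : Stream' D}
    (hinf : ∀ N, ∃ n, N < (M.outWord M.start (w.take n)).length)
    (hy : ∀ n, M.outWord M.start (w.take n) = y.take (M.outWord M.start (w.take n)).length) :
    M.output w = Stream'.Seq.ofStream y := by
  apply Stream'.Seq.ext
  intro i
  refine (dif_pos (hinf i)).trans ?_
  rw [← List.getElem?_eq_getElem, hy, Stream'.getElem?_take (Nat.find_spec (hinf i))]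
  rfl

end Transducer

theorem mainTheorem3 {S D Q : Type*} [Finite S] [Finite D] [Finite Q]
    (M : Transducer S D Q) (x : Stream' S) (hx : IsMorphic x) :
    (∃ y : Stream' D, IsMorphic y ∧ M.output (Stream'.Seq.ofStream x) = Stream'.Seq.ofStream y) ∨
      (M.output (Stream'.Seq.ofStream x)).Terminates := by
  by_cases hinf : ∀ N, ∃ n, N < (M.outWord M.start ((Stream'.Seq.ofStream x).take n)).length
  swap
  · push Not at hinf
    obtain ⟨N, hN⟩ := hinf
    exact Or.inr (M.output_terminates hN)
  left
  obtain ⟨A, _, w, c, ⟨h₀, s, hs, hlim₀⟩, rfl⟩ := hx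
  let step : Q → A → Q := fun q a => M.step q (c a)
  obtain ⟨p, hp, hstep⟩ := exists_pos_morphismPow_foldl step h₀
  set h := morphismPow h₀ p with hdef
  have hlim : WordTendsto (fun n => (extendMorphism h)^[n] s) (Stream'.Seq.ofStream w) :=
    hlim₀.morphismPow hp
  simp only [← extendMorphism_morphismPow_self, ← hdef] at hstep
  let ann : List A → List (A × Q × Q) := annotate step h (M.start, M.start)
  let f : A × Q × Q → List D := fun b => M.out b.2.1 (c b.1)
  obtain ⟨z, hz, hztake⟩ := exists_wordTendsto_of_eventually_prefix
    (u := fun n => (extendMorphism (annotateMorphism step h))^[n] (ann s))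
    (v := fun L => ann (w.take L))
    (fun L => by
      filter_upwards [wordTendsto_ofStream_iff.1 hlim L] with n hn
      obtain ⟨t, ht⟩ := hn
      rw [← annotate_iterate hstep, ← ht, annotate_append]
      exact List.prefix_append _ _)
    (fun N => ⟨N + 1, by simp [ann, length_annotate]⟩)
  simp only [ann, length_annotate, Stream'.length_take] at hztake
  have hout (n : ℕ) : M.outWord M.start ((Stream'.Seq.ofStream (w.map c)).take n) =
      extendMorphism f (z.take n) := by
    rw [← hztake, ← M.outWord_map c h (M.start, M.start), Stream'.Seq.take_ofStream,
      Stream'.map_take]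
  simp only [hout] at hinf
  obtain ⟨y, hy, hytake⟩ := IsPureMorphic.exists_isMorphic_of_unbounded (w := z)
    ⟨_, ann s, by simpa [ann, ← List.length_eq_zero_iff, length_annotate] using hs, hz⟩ f hinf
  exact ⟨y, hy, M.output_eq_ofStream (by simpa only [hout] using hinf)
    (by simpa only [hout] using hytake)⟩
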